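/- Let $f:\mathbb R^n\times\mathbb R^s\to\mathbb R$, $g:\mathbb R^n\times\mathbb R^s\to\mathbb R^{m_I}$, $h:\mathbb R^n\times\mathbb R^s\to\mathbb R^{m_E}$, $q=(g,h)$, and consider the parametric program $$NLP(\omega):\quad \min_x f(x,\omega)\ \text{ subject to }\ g(x,\omega)\le 0,\ h(x,\omega)=0,$$ with feasible set $\mathcal F(\omega)$. Fix $(\bar x,\bar\omega)\in\mathbb R^n\times\mathbb R^s$ and assume: (a) There are neighborhoods $U_0$ of $\bar x$ and $W_0$ of $\bar\omega$ such that $f$ and $q$ are twice partially differentiable with respect to $x$ on $U_0\times W_0$; $q,\nabla_xf,\nabla_xq,\nabla_x^2f,\nabla_x^2q$ are continuous at $(\bar x,\bar\omega)$; and $\nabla_x^2f(\cdot,\omega)$, $\nabla_x^2q(\cdot,\omega)$ are continuous on $U_0$ for every $\omega\in W_0$. (b) $f(\bar x,\cdot)$, $\nabla_xf(\bar x,\cdot)$, $q(\bar x,\cdot)$ and $\nabla_xq(\bar x,\cdot)$ are Lipschitz near $\bar\omega$. Put $\mathcal L^{\lambda_0}(x,\lambda^g,\lambda^h,\omega)=\lambda_0f(x,\omega)+\sum_i\lambda^g_ig_i(x,\omega)+\sum_j\lambda^h_jh_j(x,\omega)$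 and let $$\Lambda(\bar x,\bar\omega)=\{(\lambda^g,\lambda^h)\in\mathbb R^{m_I}_+\times\mathbb R^{m_E} : \nabla_x\mathcal L^1(\bar x,\lambda^g,\lambda^h,\bar\omega)=0,\ (\lambda^g)^Tg(\bar x,\bar\omega)=0\}$$ be the set of KKT multipliers. Let $\bar I_g=\{i: g_i(\bar x,\bar\omega)=0\}$ and $$T^{\rm lin}=\{u\in\mathbb R^n: \nabla_xg_i(\bar x,\bar\omega)u\le0\ (i\in\bar I_g),\ \nabla_xh_j(\bar x,\bar\omega)u=0\ (j=1,\dots,m_E)\}.$$ For $x\in\mathcal F(\omega)$, let $\hat N(x;\mathcal F(\omega))=\{\xi:\limsup_{x'\to x,\,x'\in\mathcal F(\omega)\setminus\{x\}}\xi^T(x'-x)/\|x'-x\|\le0\}$ be the regular (Fréchet) normal cone (empty if $x\notin\mathcal F(\omega)$), and let the stationary map be $$S(\omega)=\{x : 0\in\nabla_xf(x,\omega)+\hat N(x;\mathcal F(\omega))\}.$$ Suppose that $\bar x$ is a KKT point of $NLP(\bar\omega)$ (i.e. $\bar x\in\mathcal F(\bar\omega)$ and $\Lambda(\bar x,\bar\omega)\neq\emptyset$)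 and that MFCQ holds at $(\bar x,\bar\omega)$: the gradients $\nabla_xh_j(\bar x,\bar\omega)$, $j=1,\dots,m_E$, are linearly independent and there is $d\in\mathbb R^n$ with $\nabla_xh_j(\bar x,\bar\omega)d=0$ for all $j$ and $\nabla_xg_i(\bar x,\bar\omega)d<0$ for all $i\in\bar I_g$. Suppose further that, for every $(\lambda^g,\lambda^h)\in\Lambda(\bar x,\bar\omega)$, the system $$\begin{array}{l} u\in T^{\rm lin},\quad (\alpha,\beta)\in\mathbb R^{m_I}\times\mathbb R^{m_E},\\ \nabla_x^2\mathcal L^1(\bar x,\lambda^g,\lambda^h,\bar\omega)u+\nabla_x\mathcal L^0(\bar x,\alpha,\beta,\bar\omega)=0,\\ \nabla_xg_i(\bar x,\bar\omega)u=0\quad\text{if } i\in\bar I_g,\ \lambda^g_i>0,\\ \alpha_i\ge0,\ \alpha_i\nabla_xg_i(\bar x,\bar\omega)u=0\quad\text{if } i\in\bar I_g,\ \lambda^g_i=0,\\ \alpha_i=0\quad\text{if } i\notin\bar I_g \end{array}$$ has no solution $(u,\alpha,\beta)$ with $u\ne0$. Then $S$ is locally upper Lipschitz at $(\bar\omega,\bar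 x)$: $\bar x\in S(\bar\omega)$, and there are neighborhoods $U$ of $\bar x$, $W$ of $\bar\omega$ and a constant $L>0$ such that $\|x-\bar x\|\le L\|\omega-\bar\omega\|$ for all $\omega\in W$ and all $x\in S(\omega)\cap U$. -/

import Mathlib

open scoped Topology

noncomputable section

/-- The data of the parametric nonlinear program
`NLP(ω) : min f(x, ω)  subject to  g(x, ω) ≤ 0, h(x, ω) = 0`, with `x ∈ ℝⁿ`, `ω ∈ ℝˢ`,
`mI` inequality constraints and `mE` equality constraints. -/
structure ParametricNLP (n s mI mE : ℕ) where
  /-- objective -/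
  f : EuclideanSpace ℝ (Fin n) → EuclideanSpace ℝ (Fin s) → ℝ
  /-- inequality constraint functions -/
  g : Fin mI → EuclideanSpace ℝ (Fin n) → EuclideanSpace ℝ (Fin s) → ℝ
  /-- equality constraint functions -/
  h : Fin mE → EuclideanSpace ℝ (Fin n) → EuclideanSpace ℝ (Fin s) → ℝ

/-- The partial gradient `∇ₓ φ(x, ω)`. -/
def gradX {n s : ℕ} (φ : EuclideanSpace ℝ (Fin n) → EuclideanSpace ℝ (Fin s) → ℝ)
    (x : EuclideanSpace ℝ (Fin n)) (ω : EuclideanSpace ℝ (Fin s)) : EuclideanSpace ℝ (Fin n) :=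
  gradient (fun y => φ y ω) x

/-- The partial Hessian `∇ₓ² φ(x, ω)`, as a linear map of `ℝⁿ`. -/
def hessX {n s : ℕ} (φ : EuclideanSpace ℝ (Fin n) → EuclideanSpace ℝ (Fin s) → ℝ)
    (x : EuclideanSpace ℝ (Fin n)) (ω : EuclideanSpace ℝ (Fin s)) :
    EuclideanSpace ℝ (Fin n) →L[ℝ] EuclideanSpace ℝ (Fin n) :=
  fderiv ℝ (fun y => gradX φ y ω) x

/-- `φ` is twice partially differentiable with respect to `x` on `U × W`, the functions
`∇ₓ φ` and `∇ₓ² φ` are continuous at `(xb, ωb)`, and `∇ₓ² φ(·, ω)` is continuous on `U` for every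
`ω ∈ W`. -/
structure IsTwiceSmoothInX {n s : ℕ}
    (φ : EuclideanSpace ℝ (Fin n) → EuclideanSpace ℝ (Fin s) → ℝ)
    (xb : EuclideanSpace ℝ (Fin n)) (ωb : EuclideanSpace ℝ (Fin s))
    (U : Set (EuclideanSpace ℝ (Fin n))) (W : Set (EuclideanSpace ℝ (Fin s))) : Prop where
  differentiable : ∀ x ∈ U, ∀ ω ∈ W, DifferentiableAt ℝ (fun y => φ y ω) x
  grad_differentiable : ∀ x ∈ U, ∀ ω ∈ W, DifferentiableAt ℝ (fun y => gradX φ y ω) x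
  grad_continuousAt : ContinuousAt
    (fun p : EuclideanSpace ℝ (Fin n) × EuclideanSpace ℝ (Fin s) => gradX φ p.1 p.2) (xb, ωb)
  hess_continuousAt : ContinuousAt
    (fun p : EuclideanSpace ℝ (Fin n) × EuclideanSpace ℝ (Fin s) => hessX φ p.1 p.2) (xb, ωb)
  hess_continuousOn : ∀ ω ∈ W, ContinuousOn (fun x => hessX φ x ω) U

/-- `F` is Lipschitz continuous on some neighbourhood of `ωb`. -/
def LipschitzNear {s : ℕ} {Y : Type*} [PseudoEMetricSpace Y]
    (F : EuclideanSpace ℝ (Fin s) → Y) (ωb : EuclideanSpace ℝ (Fin s)) : Prop :=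
  ∃ K : NNReal, ∃ W ∈ 𝓝 ωb, LipschitzOnWith K F W

/-- The regular (Fréchet) normal cone to `Γ` at `x`: all `ξ` such that the upper limit of
`⟪ξ, x' - x⟫ / ‖x' - x‖`, as `x' → x` in `Γ`, is at most `0`; it is empty if `x ∉ Γ`. -/
def frechetNormalCone {n : ℕ} (Γ : Set (EuclideanSpace ℝ (Fin n)))
    (x : EuclideanSpace ℝ (Fin n)) : Set (EuclideanSpace ℝ (Fin n)) :=
  {ξ | x ∈ Γ ∧ ∀ ε : ℝ, 0 < ε → ∀ᶠ x' in 𝓝[Γ] x, inner ℝ ξ (x' - x) ≤ ε * ‖x' - x‖}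

/-- A set-valued map `S` with `xb ∈ S ωb` is locally upper Lipschitz at `(ωb, xb)` if there are
neighbourhoods `U` of `xb` and `W` of `ωb` and a constant `L > 0` with
`S ω ∩ U ⊆ xb + L ‖ω - ωb‖ 𝔹` for all `ω ∈ W`. -/
def IsLocallyUpperLipschitzAt {n s : ℕ}
    (S : EuclideanSpace ℝ (Fin s) → Set (EuclideanSpace ℝ (Fin n)))
    (ωb : EuclideanSpace ℝ (Fin s)) (xb : EuclideanSpace ℝ (Fin n)) : Prop :=
  xb ∈ S ωb ∧ ∃ U ∈ 𝓝 xb, ∃ W ∈ 𝓝 ωb, ∃ L : ℝ, 0 < L ∧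
    ∀ ω ∈ W, S ω ∩ U ⊆ Metric.closedBall xb (L * ‖ω - ωb‖)

namespace ParametricNLP

/-- The basic smoothness assumption at `(xb, ωb)`. -/
def BasicAssumption {n s mI mE : ℕ} (D : ParametricNLP n s mI mE)
    (xb : EuclideanSpace ℝ (Fin n)) (ωb : EuclideanSpace ℝ (Fin s)) : Prop :=
  (∃ U ∈ 𝓝 xb, ∃ W ∈ 𝓝 ωb,
    IsTwiceSmoothInX D.f xb ωb U W ∧
    (∀ i, IsTwiceSmoothInX (D.g i) xb ωb U W) ∧
    (∀ j, IsTwiceSmoothInX (D.h j) xb ωb U W)) ∧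
  (∀ i, ContinuousAt (fun p : EuclideanSpace ℝ (Fin n) × EuclideanSpace ℝ (Fin s) =>
    D.g i p.1 p.2) (xb, ωb)) ∧
  (∀ j, ContinuousAt (fun p : EuclideanSpace ℝ (Fin n) × EuclideanSpace ℝ (Fin s) =>
    D.h j p.1 p.2) (xb, ωb))

/-- The functions `f(xb, ·)`, `∇ₓ f(xb, ·)`, `(g, h)(xb, ·)` and `∇ₓ (g, h)(xb, ·)` are Lipschitz
near `ωb`. -/
def LipschitzData {n s mI mE : ℕ} (D : ParametricNLP n s mI mE)
    (xb : EuclideanSpace ℝ (Fin n)) (ωb : EuclideanSpace ℝ (Fin s)) : Prop :=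
  LipschitzNear (fun ω => D.f xb ω) ωb ∧
  LipschitzNear (fun ω => gradX D.f xb ω) ωb ∧
  (∀ i, LipschitzNear (fun ω => D.g i xb ω) ωb) ∧
  (∀ i, LipschitzNear (fun ω => gradX (D.g i) xb ω) ωb) ∧
  (∀ j, LipschitzNear (fun ω => D.h j xb ω) ωb) ∧
  (∀ j, LipschitzNear (fun ω => gradX (D.h j) xb ω) ωb)

/-- The feasible set of `NLP(ω)`. -/
def feasibleSet {n s mI mE : ℕ} (D : ParametricNLP n s mI mE)
    (ω : EuclideanSpace ℝ (Fin s)) : Set (EuclideanSpace ℝ (Fin n)) :=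
  {x | (∀ i, D.g i x ω ≤ 0) ∧ (∀ j, D.h j x ω = 0)}

/-- The stationary map `S`: the (B-)stationary points of `NLP(ω)`, that is, the solutions of
`0 ∈ ∇ₓ f(x, ω) + N̂(x; feasible set)`. -/
def stationarySet {n s mI mE : ℕ} (D : ParametricNLP n s mI mE)
    (ω : EuclideanSpace ℝ (Fin s)) : Set (EuclideanSpace ℝ (Fin n)) :=
  {x | ∃ ξ ∈ frechetNormalCone (D.feasibleSet ω) x, gradX D.f x ω + ξ = 0}

/-- The extended Lagrangian `l0 f + ∑ lg i * g i + ∑ lh j * h j`. -/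
def lagrangian {n s mI mE : ℕ} (D : ParametricNLP n s mI mE) (l0 : ℝ)
    (lg : Fin mI → ℝ) (lh : Fin mE → ℝ)
    (x : EuclideanSpace ℝ (Fin n)) (ω : EuclideanSpace ℝ (Fin s)) : ℝ :=
  l0 * D.f x ω + ∑ i, lg i * D.g i x ω + ∑ j, lh j * D.h j x ω

/-- The set of KKT multipliers associated with `x` in `NLP(ω)`. -/
def multipliers {n s mI mE : ℕ} (D : ParametricNLP n s mI mE)
    (x : EuclideanSpace ℝ (Fin n)) (ω : EuclideanSpace ℝ (Fin s)) :
    Set ((Fin mI → ℝ) × (Fin mE → ℝ)) :=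
  {l | (∀ i, 0 ≤ l.1 i) ∧ gradX (D.lagrangian 1 l.1 l.2) x ω = 0 ∧ ∑ i, l.1 i * D.g i x ω = 0}

/-- `x` is a stationary solution of `NLP(ω)` in the Karush-Kuhn-Tucker sense. -/
def IsKKTPoint {n s mI mE : ℕ} (D : ParametricNLP n s mI mE)
    (x : EuclideanSpace ℝ (Fin n)) (ω : EuclideanSpace ℝ (Fin s)) : Prop :=
  x ∈ D.feasibleSet ω ∧ (D.multipliers x ω).Nonempty

/-- The Mangasarian-Fromovitz constraint qualification at `(x, ω)`. -/
def MFCQ {n s mI mE : ℕ} (D : ParametricNLP n s mI mE)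
    (x : EuclideanSpace ℝ (Fin n)) (ω : EuclideanSpace ℝ (Fin s)) : Prop :=
  LinearIndependent ℝ (fun j => gradX (D.h j) x ω) ∧
  ∃ d : EuclideanSpace ℝ (Fin n), (∀ j, inner ℝ (gradX (D.h j) x ω) d = 0) ∧
    ∀ i, D.g i x ω = 0 → inner ℝ (gradX (D.g i) x ω) d < 0

/-- The linearized tangent cone to the feasible set of `NLP(ω)` at `x`. -/
def linTangentCone {n s mI mE : ℕ} (D : ParametricNLP n s mI mE)
    (x : EuclideanSpace ℝ (Fin n)) (ω : EuclideanSpace ℝ (Fin s)) :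
    Set (EuclideanSpace ℝ (Fin n)) :=
  {u | (∀ i, D.g i x ω = 0 → inner ℝ (gradX (D.g i) x ω) u ≤ 0) ∧
    ∀ j, inner ℝ (gradX (D.h j) x ω) u = 0}

/-- `(u, α, β)` solves the linearized system at `(x, ω)` for the multiplier `(lg, lh)`. -/
structure SolvesLinearizedSystem {n s mI mE : ℕ} (D : ParametricNLP n s mI mE)
    (x : EuclideanSpace ℝ (Fin n)) (ω : EuclideanSpace ℝ (Fin s))
    (lg : Fin mI → ℝ) (lh : Fin mE → ℝ)
    (u : EuclideanSpace ℝ (Fin n)) (α : Fin mI → ℝ) (β : Fin mE → ℝ) : Prop where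
  mem_cone : u ∈ D.linTangentCone x ω
  stationarity : hessX (D.lagrangian 1 lg lh) x ω u + gradX (D.lagrangian 0 α β) x ω = 0
  strongly_active : ∀ i, D.g i x ω = 0 → 0 < lg i → inner ℝ (gradX (D.g i) x ω) u = 0
  weakly_active : ∀ i, D.g i x ω = 0 → lg i = 0 →
    0 ≤ α i ∧ α i * inner ℝ (gradX (D.g i) x ω) u = 0
  inactive : ∀ i, D.g i x ω ≠ 0 → α i = 0

end ParametricNLP

end

/-!
The estimate is proved by contradiction. If it fails, there are stationary points `x k` of
`NLP(ω k)` with `x k → xb`, `ω k → ωb` and `ω k - ωb = o(x k - xb)`.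

The Mangasarian-Fromovitz condition is stable under small perturbations: by means of the Gram matrix
of the equality gradients one gets biorthogonal families that converge
(`exists_tendsto_biorthogonal`), and with them the strictly feasible direction is corrected
(`exists_tendsto_orthogonal`). Hence, by Lyusternik's theorem and Farkas' lemma, regular normals to
the feasible sets near the base point are combinations of active gradients
(`mem_signedCone_of_mem_frechetNormalCone`), so the `x k` are KKT points, and their multipliers are
bounded (`ParametricNLP.RegularData.exists_bounded_multipliers`). Along a subsequence the
multipliers converge to some `l` and the normalized differences `(x k - xb) / ‖x k - xb‖` converge
to a unit vector `u`.

Dividing the KKT conditions at `x k` by `‖x k - xb‖` and passing to the limit shows that `l` is a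
multiplier at `xb` and that `u` solves the linearized system for `l`
(`ParametricNLP.RegularData.solvesLinearizedSystem_of_tendsto`), contrary to assumption. The
quotients of the constraint functions and of the gradients converge because the parameters converge
faster than the points (`tendsto_inv_norm_smul_sub`). The quotients of the multiplier differences
need not converge, but the combinations of gradients that they define lie in a finitely generated
cone. Such a cone is closed (`isClosed_signedCone`), so the limit of these combinations has
coefficients `α`, `β` with the required signs.
-/

open Filter Asymptotics

/-! ### Finitely generated cones -/

section Cone

variable {ι E : Type*} [NormedAddCommGroup E] [InnerProductSpace ℝ E]

/-- The cone of all combinations `∑ i ∈ s, c i • v i` in which the coefficients with index in `N`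
are nonnegative and the other ones are free. -/
def signedCone (s : Finset ι) (N : Set ι) (v : ι → E) : PointedCone ℝ E where
  carrier := {x | ∃ c : ι → ℝ, (∀ i ∈ s, i ∈ N → 0 ≤ c i) ∧ ∑ i ∈ s, c i • v i = x}
  add_mem' := by
    rintro _ _ ⟨c, hc, rfl⟩ ⟨c', hc', rfl⟩
    exact ⟨c + c', fun i hs hi => add_nonneg (hc i hs hi) (hc' i hs hi), by
      simp [add_smul, Finset.sum_add_distrib]⟩
  zero_mem' := ⟨0, by simp, by simp⟩
  smul_mem' := by
    rintro r _ ⟨c, hc, rfl⟩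
    refine ⟨fun i => (r : ℝ) * c i, fun i hs hi => mul_nonneg r.2 (hc i hs hi), ?_⟩
    rw [Finset.smul_sum]
    exact Finset.sum_congr rfl fun i _ => mul_smul _ _ _

theorem mem_signedCone {s : Finset ι} {N : Set ι} {v : ι → E} {x : E} :
    x ∈ signedCone s N v ↔
      ∃ c : ι → ℝ, (∀ i ∈ s, i ∈ N → 0 ≤ c i) ∧ ∑ i ∈ s, c i • v i = x := Iff.rfl

theorem mem_signedCone_iff_support [Fintype ι] {s : Finset ι} {N : Set ι} {v : ι → E} {x : E} :
    x ∈ signedCone s N v ↔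
      ∃ c : ι → ℝ, (∀ i ∈ N, 0 ≤ c i) ∧ (∀ i ∉ s, c i = 0) ∧ ∑ i, c i • v i = x := by
  classical
  constructor
  · rintro ⟨c, hc, rfl⟩
    refine ⟨fun i => if i ∈ s then c i else 0, fun i hi => ?_, fun i hi => if_neg hi, ?_⟩
    · dsimp only
      split_ifs with h
      exacts [hc i h hi, le_rfl]
    · simp [ite_smul, Finset.sum_ite_mem]
  · rintro ⟨c, hc, hc0, rfl⟩
    refine ⟨c, fun i _ hi => hc i hi, Finset.sum_subset (Finset.subset_univ s) fun i _ hi => ?_⟩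
    rw [hc0 i hi, zero_smul]

theorem mem_signedCone_insert [DecidableEq ι] {s : Finset ι} {N : Set ι} {v : ι → E} {a : ι}
    (ha : a ∉ s) {x : E} :
    x ∈ signedCone (insert a s) N v ↔
      ∃ t : ℝ, (a ∈ N → 0 ≤ t) ∧ x - t • v a ∈ signedCone s N v := by
  constructor
  · rintro ⟨c, hc, rfl⟩
    refine ⟨c a, hc a (Finset.mem_insert_self a s), c,
      fun i hs => hc i (Finset.mem_insert_of_mem hs), ?_⟩
    rw [Finset.sum_insert ha, add_sub_cancel_left]
  · rintro ⟨t, ht, c, hc, hx⟩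
    have hne : ∀ i ∈ s, i ≠ a := fun i hi h => ha (h ▸ hi)
    refine ⟨Function.update c a t, fun i hs hi => ?_, ?_⟩
    · rcases Finset.mem_insert.1 hs with rfl | hs
      · simpa using ht hi
      · simpa [hne i hs] using hc i hs hi
    · rw [Finset.sum_insert ha, Finset.sum_congr rfl (g := fun i => c i • v i)
        fun i hi => by rw [Function.update_of_ne (hne i hi)], hx]
      simp

/-- Adding a ray to a closed cone gives a closed set unless the opposite ray lies in the cone. -/
theorem isClosed_add_ray {K : PointedCone ℝ E} (hK : IsClosed (K : Set E)) {w : E}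
    (hw : -w ∉ K) : IsClosed {x : E | ∃ t : ℝ, 0 ≤ t ∧ x - t • w ∈ K} := by
  -- `-w` has positive distance from `K`, which bounds `t` in terms of `x`.
  obtain ⟨ε, hε, hball⟩ := Metric.isOpen_iff.1 hK.isOpen_compl (-w) hw
  have bound : ∀ x : E, ∀ t : ℝ, 0 < t → x - t • w ∈ K → t ≤ ‖x‖ / ε := by
    intro x t ht hx
    have h1 : t⁻¹ • x - w ∈ K := by
      have := K.smul_mem (inv_nonneg.2 ht.le) hx
      rwa [smul_sub, smul_smul, inv_mul_cancel₀ ht.ne', one_smul] at this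
    have h3 : ε ≤ ‖t⁻¹ • x‖ := by
      by_contra hlt
      push Not at hlt
      refine hball ?_ h1
      rw [Metric.mem_ball, dist_eq_norm]
      simpa using hlt
    rw [norm_smul, norm_inv, Real.norm_of_nonneg ht.le, inv_mul_eq_div, le_div_iff₀ ht] at h3
    rw [le_div_iff₀ hε]
    linarith
  refine IsSeqClosed.isClosed fun x y hx hxy => ?_
  choose t ht htK using hx
  obtain ⟨M, hM⟩ := hxy.norm.bddAbove_range
  have htM : ∀ n, t n ∈ Set.Icc 0 (M / ε) := fun n => ⟨ht n, by
    have hMn : ‖x n‖ ≤ M := hM ⟨n, rfl⟩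
    rcases (ht n).eq_or_lt with h | h
    · rw [← h]
      exact div_nonneg ((norm_nonneg _).trans hMn) hε.le
    · exact (bound _ _ h (htK n)).trans (by gcongr)⟩
  obtain ⟨τ, hτ, φ, hφ, hlim⟩ := isCompact_Icc.tendsto_subseq htM
  refine ⟨τ, hτ.1, hK.mem_of_tendsto ((hxy.comp hφ.tendsto_atTop).sub (hlim.smul_const w))
    (Filter.Eventually.of_forall fun n => htK (φ n))⟩

/-- The set `K + ℝ w` is the preimage of the image of `K` under the projection along `w`. -/
theorem isClosed_add_line {K : PointedCone ℝ E} {w : E} {P : E →L[ℝ] E}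
    (hP : ∀ x, ∃ t : ℝ, x - P x = t • w) (hw : P w = 0) (hK : IsClosed (P '' K)) :
    IsClosed {x : E | ∃ t : ℝ, x - t • w ∈ K} := by
  convert hK.preimage P.continuous using 1
  ext x
  constructor
  · rintro ⟨t, ht⟩
    exact ⟨_, ht, by simp [hw]⟩
  · rintro ⟨y, hy, hxy⟩
    obtain ⟨t, ht⟩ := hP x
    obtain ⟨r, hr⟩ := hP y
    refine ⟨t - r, ?_⟩
    rw [sub_smul, ← ht, ← hr, hxy]
    simpa using hy

theorem image_signedCone (s : Finset ι) (N : Set ι) (v : ι → E) (P : E →L[ℝ] E) :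
    P '' (signedCone s N v) = signedCone s N (P ∘ v) := by
  ext x
  constructor
  · rintro ⟨_, ⟨c, hc, rfl⟩, rfl⟩
    exact ⟨c, hc, by simp⟩
  · rintro ⟨c, hc, rfl⟩
    exact ⟨_, ⟨c, hc, rfl⟩, by simp⟩

/-- Induction on the number of generators: a generator whose ray is opposite to an element of the
cone contributes a whole line, which is projected away; any other ray may simply be added. -/
theorem isClosed_signedCone (s : Finset ι) (N : Set ι) (v : ι → E) :
    IsClosed (signedCone s N v : Set E) := by
  classical
  induction s using Finset.induction_on generalizing v with
  | empty =>
    convert isClosed_singleton (x := (0 : E)) using 1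
    ext x
    simp [mem_signedCone, eq_comm]
  | insert a s ha ih =>
    set K := signedCone s N v with hKdef
    by_cases hline : a ∈ N ∧ -v a ∉ K
    · convert isClosed_add_ray (ih v) hline.2 using 1
      ext x
      simp [mem_signedCone_insert ha, hline.1]
    · let P : E →L[ℝ] E := ContinuousLinearMap.id ℝ E -
        ((‖v a‖ ^ 2)⁻¹ • innerSL ℝ (v a)).smulRight (v a)
      have hPv : P (v a) = 0 := by
        by_cases h0 : v a = 0
        · simp [P, h0]
        · have : ‖v a‖ ^ 2 ≠ 0 := by simpa using h0
          simp [P, this]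
      have hP : ∀ x, ∃ t : ℝ, x - P x = t • v a :=
        fun x => ⟨(‖v a‖ ^ 2)⁻¹ * inner ℝ (v a) x, by simp [P]⟩
      convert isClosed_add_line (K := K) hP hPv (by rw [hKdef, image_signedCone]; exact ih _)
        using 1
      ext x
      rw [SetLike.mem_coe, mem_signedCone_insert ha]
      refine ⟨fun ⟨t, _, ht⟩ => ⟨t, ht⟩, fun ⟨t, ht⟩ => ?_⟩
      by_cases haN : a ∈ N
      · have hneg : -v a ∈ K := by
          by_contra h
          exact hline ⟨haN, h⟩
        -- Adding a multiple of `-v a ∈ K` makes the coefficient of `v a` nonnegative.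
        refine ⟨|t|, fun _ => abs_nonneg t, ?_⟩
        convert K.add_mem ht (K.smul_mem (sub_nonneg.2 (le_abs_self t)) hneg) using 1
        module
      · exact ⟨t, fun h => absurd h haN, ht⟩

/-- Farkas' lemma for systems of linear inequalities and equations. -/
theorem mem_signedCone_of_forall_inner_nonpos [CompleteSpace E] {s : Finset ι} {N : Set ι}
    {v : ι → E} {ξ : E}
    (h : ∀ u : E, (∀ i ∈ s, i ∈ N → inner ℝ (v i) u ≤ 0) →
      (∀ i ∈ s, i ∉ N → inner ℝ (v i) u = 0) → inner ℝ ξ u ≤ 0) :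
    ξ ∈ signedCone s N v := by
  classical
  by_contra hξ
  let K : ProperCone ℝ E := ⟨signedCone s N v, isClosed_signedCone s N v⟩
  obtain ⟨u, hu, hξu⟩ := ProperCone.hyperplane_separation' K (x₀ := ξ) hξ
  have key : ∀ i ∈ s, ∀ t : ℝ, (i ∈ N → 0 ≤ t) → 0 ≤ t * inner ℝ (v i) u := by
    intro i hi t ht
    have : t • v i ∈ K := by
      refine ⟨Pi.single i t, fun j _ hj => ?_, ?_⟩
      · rcases eq_or_ne j i with rfl | hne
        · simpa using ht hj
        · simp [hne]
      · rw [Finset.sum_eq_single i (fun j _ hj => by simp [hj]) (fun h' => absurd hi h')]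
        simp
    simpa [real_inner_smul_left] using hu _ this
  have := h (-u) (fun i hi hN => ?_) (fun i hi hN => ?_)
  · rw [inner_neg_right] at this
    linarith
  · have := key i hi 1 (fun _ => zero_le_one)
    rw [inner_neg_right]
    linarith
  · have h1 := key i hi 1 (fun h' => absurd h' hN)
    have h2 := key i hi (-1) (fun h' => absurd h' hN)
    rw [inner_neg_right]
    linarith

end Cone

/-! ### First-order expansions with parameters -/

/-- First-order expansion in `x`, uniform in the parameter `w`: mean value inequality along the
segment from `(xb, w)` to `(x, w)`. -/
theorem isLittleO_sub_sub_partial {E W G : Type*} [NormedAddCommGroup E] [NormedSpace ℝ E]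
    [PseudoMetricSpace W] [NormedAddCommGroup G] [NormedSpace ℝ G] {F : E → W → G}
    {F' : E × W → E →L[ℝ] G} {xb : E} {wb : W}
    (hF : ∀ᶠ p in 𝓝 (xb, wb), HasFDerivAt (fun y => F y p.2) (F' p) p.1)
    (hF' : ContinuousAt F' (xb, wb)) :
    (fun p : E × W => F p.1 p.2 - F xb p.2 - F' (xb, wb) (p.1 - xb))
      =o[𝓝 (xb, wb)] fun p => p.1 - xb := by
  rw [isLittleO_iff]
  intro c hc
  have hclose : ∀ᶠ p in 𝓝 (xb, wb), ‖F' p - F' (xb, wb)‖ ≤ c := by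
    filter_upwards [Metric.continuousAt_iff'.1 hF' c hc] with p hp
    rw [← dist_eq_norm]
    exact hp.le
  obtain ⟨r, hr, hball⟩ := Metric.eventually_nhds_iff_ball.1 (hF.and hclose)
  filter_upwards [Metric.ball_mem_nhds _ hr] with p hp
  rw [← ball_prod_same] at hball hp
  refine (convex_ball xb r).norm_image_sub_le_of_norm_hasFDerivWithin_le'
    (f := fun y => F y p.2) (f' := fun y => F' (y, p.2))
    (fun y hy => (hball (y, p.2) ⟨hy, hp.2⟩).1.hasFDerivWithinAt)
    (fun y hy => (hball (y, p.2) ⟨hy, hp.2⟩).2) (Metric.mem_ball_self hr) hp.1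

theorem LipschitzNear.isBigO {s : ℕ} {Y : Type*} [SeminormedAddCommGroup Y]
    {F : EuclideanSpace ℝ (Fin s) → Y} {ωb : EuclideanSpace ℝ (Fin s)} (hF : LipschitzNear F ωb) :
    (fun ω => F ω - F ωb) =O[𝓝 ωb] fun ω => ω - ωb := by
  obtain ⟨K, W, hW, hK⟩ := hF
  refine IsBigO.of_bound K ?_
  filter_upwards [hW] with ω hω
  exact hK.norm_sub_le hω (mem_of_mem_nhds hW)

/-- If the parameters converge faster than the points, then a map which is Lipschitz in the
parameter has the same first-order expansion as if the parameter were fixed. -/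
theorem isLittleO_sub_sub_of_lipschitzNear {s : ℕ} {E G : Type*} [NormedAddCommGroup E]
    [NormedSpace ℝ E] [NormedAddCommGroup G] [NormedSpace ℝ G]
    {F : E → EuclideanSpace ℝ (Fin s) → G} {F' : E × EuclideanSpace ℝ (Fin s) → E →L[ℝ] G}
    {xb : E} {ωb : EuclideanSpace ℝ (Fin s)}
    (hF : ∀ᶠ p in 𝓝 (xb, ωb), HasFDerivAt (fun y => F y p.2) (F' p) p.1)
    (hF' : ContinuousAt F' (xb, ωb)) (hLip : LipschitzNear (F xb) ωb)
    {α : Type*} {l : Filter α} {x : α → E} {ω : α → EuclideanSpace ℝ (Fin s)}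
    (hx : Tendsto x l (𝓝 xb)) (hω : Tendsto ω l (𝓝 ωb))
    (hωx : (fun k => ω k - ωb) =o[l] fun k => x k - xb) :
    (fun k => F (x k) (ω k) - F xb ωb - F' (xb, ωb) (x k - xb)) =o[l] fun k => x k - xb := by
  have h1 := (isLittleO_sub_sub_partial hF hF').comp_tendsto (hx.prodMk_nhds hω)
  have h2 := (hLip.isBigO.comp_tendsto hω).trans_isLittleO hωx
  refine (h1.add h2).congr_left fun k => ?_
  simp only [Function.comp_apply]
  abel

/-! ### Regular normals under the Mangasarian-Fromovitz condition -/

/-- Lyusternik's theorem: every direction in the kernel of a surjective derivative is tangent to a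
curve in the level set. -/
theorem exists_curve_of_surjective {E G : Type*} [NormedAddCommGroup E] [NormedSpace ℝ E]
    [CompleteSpace E] [NormedAddCommGroup G] [NormedSpace ℝ G] [FiniteDimensional ℝ G]
    {H : E → G} {H' : E →L[ℝ] G} {x d : E} (hH : HasStrictFDerivAt H H' x)
    (hsurj : Function.Surjective H') (hd : H' d = 0) :
    ∃ γ : ℝ → E, γ 0 = x ∧ HasDerivAt γ d 0 ∧ ∀ᶠ t in 𝓝 0, H (γ t) = H x := by
  have hrange : H'.range = ⊤ := LinearMap.range_eq_top.2 hsurj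
  let e : H'.ker := ⟨d, hd⟩
  have hline : Tendsto (fun t : ℝ => t • e) (𝓝 0) (𝓝 0) := by
    have : Continuous fun t : ℝ => t • e := by fun_prop
    simpa using this.tendsto 0
  refine ⟨fun t => hH.implicitFunction H H' hrange (H x) (t • e), ?_, ?_, ?_⟩
  · simp
  · have h1 : HasDerivAt (fun t : ℝ => t • e) e 0 := by
      simpa using (hasDerivAt_id (0 : ℝ)).smul_const e
    have h2 := (hH.to_implicitFunction hrange).hasFDerivAt
    rw [← zero_smul ℝ e] at h2
    exact h2.comp_hasDerivAt (0 : ℝ) h1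
  · exact (tendsto_const_nhds.prodMk_nhds hline).eventually (hH.map_implicitFunction_eq hrange)

/-- A regular normal has nonpositive inner product with the initial velocity of every curve in
the set. -/
theorem inner_nonpos_of_mem_frechetNormalCone {n : ℕ} {Γ : Set (EuclideanSpace ℝ (Fin n))}
    {x ξ d : EuclideanSpace ℝ (Fin n)} (hξ : ξ ∈ frechetNormalCone Γ x)
    {γ : ℝ → EuclideanSpace ℝ (Fin n)} (h0 : γ 0 = x) (hγ : HasDerivAt γ d 0)
    (hΓ : ∀ᶠ t in 𝓝[>] 0, γ t ∈ Γ) : inner ℝ ξ d ≤ 0 := by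
  have hslope : Tendsto (fun t : ℝ => t⁻¹ • (γ t - x)) (𝓝[>] 0) (𝓝 d) := by
    simpa [h0] using hγ.tendsto_slope_zero_right
  have hlim : Tendsto γ (𝓝[>] 0) (𝓝[Γ] x) :=
    tendsto_nhdsWithin_iff.2 ⟨h0 ▸ hγ.continuousAt.tendsto.mono_left nhdsWithin_le_nhds, hΓ⟩
  have key : ∀ ε : ℝ, 0 < ε → inner ℝ ξ d ≤ ε * ‖d‖ := by
    intro ε hε
    refine le_of_tendsto_of_tendsto (tendsto_const_nhds.inner hslope)
      (hslope.norm.const_mul ε) ?_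
    filter_upwards [hlim.eventually (hξ.2 ε hε), self_mem_nhdsWithin] with t ht htpos
    have htpos : 0 < t := htpos
    rw [real_inner_smul_right, norm_smul, norm_inv, Real.norm_of_nonneg htpos.le, mul_left_comm]
    gcongr
  have hlim0 : Tendsto (fun ε : ℝ => ε * ‖d‖) (𝓝[>] 0) (𝓝 0) := by
    have : Continuous fun ε : ℝ => ε * ‖d‖ := by fun_prop
    simpa using (this.tendsto 0).mono_left nhdsWithin_le_nhds
  exact ge_of_tendsto hlim0 (eventually_mem_nhdsWithin.mono key)

/-- Under the Mangasarian-Fromovitz condition every regular normal to a set given by smooth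
constraints is a combination of the active constraint gradients. The linear independence of the
gradients `b j` enters through a biorthogonal family `v`. -/
theorem mem_signedCone_of_mem_frechetNormalCone {n : ℕ} {ι κ : Type*} [Finite ι] [Fintype κ]
    [DecidableEq κ] {g : ι → EuclideanSpace ℝ (Fin n) → ℝ} {h : κ → EuclideanSpace ℝ (Fin n) → ℝ}
    {x ξ d : EuclideanSpace ℝ (Fin n)} {a : ι → EuclideanSpace ℝ (Fin n)}
    {b v : κ → EuclideanSpace ℝ (Fin n)}
    (hξ : ξ ∈ frechetNormalCone {y | (∀ i, g i y ≤ 0) ∧ ∀ j, h j y = 0} x)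
    (hg : ∀ i, HasFDerivAt (g i) (innerSL ℝ (a i)) x)
    (hh : ∀ j, HasStrictFDerivAt (h j) (innerSL ℝ (b j)) x)
    (hv : ∀ i j, inner ℝ (b i) (v j) = if i = j then 1 else 0)
    (hbd : ∀ j, inner ℝ (b j) d = 0) (had : ∀ i, g i x = 0 → inner ℝ (a i) d < 0)
    {s : Finset (ι ⊕ κ)} (hs : ∀ i, Sum.inl i ∈ s ↔ g i x = 0) (hs' : ∀ j, Sum.inr j ∈ s) :
    ξ ∈ signedCone s (Set.range Sum.inl) (Sum.elim a b) := by
  -- Strictly feasible directions are velocities of feasible curves.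
  have hstrict : ∀ u, (∀ j, inner ℝ (b j) u = 0) → (∀ i, g i x = 0 → inner ℝ (a i) u < 0) →
      inner ℝ ξ u ≤ 0 := by
    intro u hbu hau
    have hH : HasStrictFDerivAt (fun y j => h j y)
        (ContinuousLinearMap.pi fun j => innerSL ℝ (b j)) x := hasStrictFDerivAt_pi.2 hh
    obtain ⟨γ, h0, hγ, hlevel⟩ := exists_curve_of_surjective (d := u) hH (fun y => by
      refine ⟨∑ j, y j • v j, ?_⟩
      ext i
      simp [hv]) (by ext j; simp [hbu])
    refine inner_nonpos_of_mem_frechetNormalCone hξ h0 hγ ?_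
    have hneg : ∀ i, ∀ᶠ t in 𝓝[>] (0 : ℝ), g i (γ t) ≤ 0 := by
      intro i
      have hgi : HasFDerivAt (g i) (innerSL ℝ (a i)) (γ 0) := h0 ▸ hg i
      rcases (hξ.1.1 i).eq_or_lt with hi | hi
      · have hder : HasDerivAt (fun t => g i (γ t)) (inner ℝ (a i) u) 0 :=
          hgi.comp_hasDerivAt (0 : ℝ) hγ
        have hsl : Tendsto (fun t : ℝ => t⁻¹ * g i (γ t)) (𝓝[>] 0) (𝓝 (inner ℝ (a i) u)) := by
          simpa [h0, hi] using hder.tendsto_slope_zero_right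
        filter_upwards [hsl.eventually (gt_mem_nhds (hau i hi)), self_mem_nhdsWithin] with t ht ht0
        have ht0 : 0 < t⁻¹ := inv_pos.2 ht0
        nlinarith
      · have hc : ContinuousAt (fun t => g i (γ t)) 0 :=
          hgi.continuousAt.comp hγ.continuousAt
        have : ∀ᶠ t in 𝓝 (0 : ℝ), g i (γ t) < 0 :=
          hc.eventually (gt_mem_nhds (by simpa [h0] using hi))
        exact (this.filter_mono nhdsWithin_le_nhds).mono fun t ht => ht.le
    filter_upwards [eventually_all.2 hneg, hlevel.filter_mono nhdsWithin_le_nhds] with t h1 h2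
    exact ⟨h1, fun j => (congrFun h2 j).trans (hξ.1.2 j)⟩
  refine mem_signedCone_of_forall_inner_nonpos fun u hle heq => ?_
  -- Strictly feasible directions are dense in the linearized cone.
  have hlim : Tendsto (fun ε : ℝ => inner ℝ ξ (u + ε • d)) (𝓝[>] 0) (𝓝 (inner ℝ ξ u)) := by
    have : Continuous fun ε : ℝ => (inner ℝ ξ (u + ε • d) : ℝ) := by fun_prop
    simpa using (this.tendsto 0).mono_left nhdsWithin_le_nhds
  refine le_of_tendsto hlim (eventually_mem_nhdsWithin.mono fun ε hε => hstrict _ ?_ ?_)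
  · intro j
    have := heq (Sum.inr j) (hs' j) (by simp)
    simp only [Sum.elim_inr] at this
    simp [inner_add_right, inner_smul_right, this, hbd]
  · intro i hi
    have h1 := hle (Sum.inl i) ((hs i).2 hi) ⟨i, rfl⟩
    simp only [Sum.elim_inl] at h1
    have h2 := mul_neg_of_pos_of_neg (show (0 : ℝ) < ε from hε) (had i hi)
    rw [inner_add_right, inner_smul_right]
    linarith

/-! ### Stability of the Mangasarian-Fromovitz condition -/

section Stability

variable {ι κ X E : Type*} [Fintype ι] [Fintype κ] [DecidableEq κ] [NormedAddCommGroup E]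
  [InnerProductSpace ℝ E] {l : Filter X}

/-- Families close to a linearly independent family have biorthogonal families that converge. -/
theorem exists_tendsto_biorthogonal {b : κ → X → E} {b₀ : κ → E}
    (hb : ∀ j, Tendsto (b j) l (𝓝 (b₀ j))) (hli : LinearIndependent ℝ b₀) :
    ∃ (v : κ → X → E) (v₀ : κ → E), (∀ j, Tendsto (v j) l (𝓝 (v₀ j))) ∧
      ∀ᶠ p in l, ∀ i j, inner ℝ (b i p) (v j p) = if i = j then 1 else 0 := by
  let G : X → Matrix κ κ ℝ := fun p => Matrix.gram ℝ fun j => b j p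
  let G₀ : Matrix κ κ ℝ := Matrix.gram ℝ b₀
  have hG : Tendsto G l (𝓝 G₀) :=
    tendsto_pi_nhds.2 fun i => tendsto_pi_nhds.2 fun j => (hb i).inner (hb j)
  have hdet₀ : G₀.det ≠ 0 := Matrix.det_gram_ne_zero_iff_linearIndependent.2 hli
  have hdet : Tendsto (fun p => (G p).det) l (𝓝 G₀.det) :=
    ((continuous_id.matrix_det).tendsto G₀).comp hG
  have hadj : Tendsto (fun p => (G p).adjugate) l (𝓝 G₀.adjugate) :=
    ((continuous_id.matrix_adjugate).tendsto G₀).comp hG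
  have hinv : Tendsto (fun p => (G p)⁻¹) l (𝓝 G₀⁻¹) := by
    simp only [Matrix.inv_def, Ring.inverse_eq_inv']
    exact (hdet.inv₀ hdet₀).smul hadj
  refine ⟨fun j p => ∑ m, (G p)⁻¹ m j • b m p, fun j => ∑ m, G₀⁻¹ m j • b₀ m, fun j => ?_, ?_⟩
  · exact tendsto_finsetSum _ fun m _ =>
      ((tendsto_pi_nhds.1 (tendsto_pi_nhds.1 hinv m)) j).smul (hb m)
  · filter_upwards [hdet.eventually_ne hdet₀] with p hp i j
    have := congrFun (congrFun (Matrix.mul_nonsing_inv (G p) hp.isUnit) i) j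
    rw [Matrix.mul_apply, Matrix.one_apply] at this
    rw [← this, inner_sum]
    exact Finset.sum_congr rfl fun m _ => by rw [inner_smul_right, mul_comm]; rfl

/-- The strictly feasible direction of the Mangasarian-Fromovitz condition can be corrected by a
biorthogonal family so as to stay orthogonal to perturbed equality gradients. -/
theorem exists_tendsto_orthogonal {b v : κ → X → E} {b₀ v₀ : κ → E} {d₀ : E}
    (hb : ∀ j, Tendsto (b j) l (𝓝 (b₀ j))) (hv : ∀ j, Tendsto (v j) l (𝓝 (v₀ j)))
    (hbv : ∀ᶠ p in l, ∀ i j, inner ℝ (b i p) (v j p) = if i = j then 1 else 0)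
    (hd : ∀ j, inner ℝ (b₀ j) d₀ = 0) :
    ∃ d : X → E, Tendsto d l (𝓝 d₀) ∧ ∀ᶠ p in l, ∀ j, inner ℝ (b j p) (d p) = 0 := by
  refine ⟨fun p => d₀ - ∑ j, (inner ℝ (b j p) d₀ : ℝ) • v j p, ?_, ?_⟩
  · have := (tendsto_const_nhds (x := d₀) (f := l)).sub (tendsto_finsetSum Finset.univ fun j _ =>
      ((hb j).inner (𝕜 := ℝ) (tendsto_const_nhds (x := d₀))).smul (hv j))
    simpa [hd] using this
  · filter_upwards [hbv] with p hp i
    simp [inner_sub_right, inner_sum, inner_smul_right, hp]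

/-- Multipliers stay bounded under the Mangasarian-Fromovitz condition: testing the stationarity
equation with the strictly feasible direction bounds the multipliers of the inequalities, and
testing it with a biorthogonal family then bounds those of the equalities. -/
theorem multipliers_isBigO_one {c : X → E} {a : ι → X → E} {b v : κ → X → E} {d : X → E} {c₀ : E}
    {a₀ : ι → E} {v₀ : κ → E} {d₀ : E} {A : Set ι} {lam : X → ι → ℝ} {mu : X → κ → ℝ}
    (hc : Tendsto c l (𝓝 c₀)) (ha : ∀ i, Tendsto (a i) l (𝓝 (a₀ i)))
    (hv : ∀ j, Tendsto (v j) l (𝓝 (v₀ j))) (hd : Tendsto d l (𝓝 d₀))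
    (hbv : ∀ᶠ p in l, ∀ i j, inner ℝ (b i p) (v j p) = if i = j then 1 else 0)
    (hbd : ∀ᶠ p in l, ∀ j, inner ℝ (b j p) (d p) = 0)
    (had : ∀ i ∈ A, inner ℝ (a₀ i) d₀ < 0)
    (hnonneg : ∀ᶠ p in l, ∀ i, 0 ≤ lam p i) (hsupp : ∀ᶠ p in l, ∀ i ∉ A, lam p i = 0)
    (hstat : ∀ᶠ p in l, c p + ∑ i, lam p i • a i p + ∑ j, mu p j • b j p = 0) :
    lam =O[l] (1 : X → ℝ) ∧ mu =O[l] (1 : X → ℝ) := by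
  have hlam : ∀ i, (fun p => lam p i) =O[l] (1 : X → ℝ) := by
    intro i
    by_cases hi : i ∈ A
    · have hlt : ∀ᶠ p in l, ∀ i, i ∈ A → inner ℝ (a i p) (d p) < 0 := by
        refine eventually_all.2 fun i => ?_
        by_cases hi : i ∈ A
        · filter_upwards [((ha i).inner hd).eventually (gt_mem_nhds (had i hi))] with p hp _
          exact hp
        · exact Eventually.of_forall fun _ h => absurd h hi
      have hquot : Tendsto (fun p => (inner ℝ (c p) (d p) : ℝ) / -inner ℝ (a i p) (d p)) l
          (𝓝 (inner ℝ c₀ d₀ / -inner ℝ (a₀ i) d₀)) :=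
        (hc.inner hd).div ((ha i).inner hd).neg (neg_ne_zero.2 (had i hi).ne)
      refine IsBigO.trans (IsBigO.of_bound 1 ?_) (hquot.isBigO_one ℝ)
      filter_upwards [hlt, hbd, hnonneg, hsupp, hstat] with p hlt hbd hnonneg hsupp hstat
      have h1 := congrArg (fun z => (inner ℝ z (d p) : ℝ)) hstat
      simp only [inner_add_left, sum_inner, real_inner_smul_left, hbd, mul_zero,
        Finset.sum_const_zero, add_zero, inner_zero_left] at h1
      have h2 : -(lam p i * inner ℝ (a i p) (d p)) ≤ ∑ i, -(lam p i * inner ℝ (a i p) (d p)) := by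
        refine Finset.single_le_sum (f := fun i => -(lam p i * inner ℝ (a i p) (d p)))
          (fun m _ => ?_) (Finset.mem_univ i)
        by_cases hm : m ∈ A
        · exact neg_nonneg.2 (mul_nonpos_of_nonneg_of_nonpos (hnonneg m) (hlt m hm).le)
        · simp [hsupp m hm]
      rw [Finset.sum_neg_distrib] at h2
      rw [one_mul, Real.norm_of_nonneg (hnonneg i)]
      refine le_trans ?_ (le_abs_self _)
      rw [le_div_iff₀ (neg_pos.2 (hlt i hi))]
      linarith
    · refine (isBigO_zero (1 : X → ℝ) l).congr' ?_ EventuallyEq.rfl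
      filter_upwards [hsupp] with p hp
      exact (hp i hi).symm
  refine ⟨isBigO_pi.2 hlam, isBigO_pi.2 fun j => ?_⟩
  have h1 : (fun p => inner ℝ (c p) (v j p) + ∑ i, lam p i * inner ℝ (a i p) (v j p))
      =O[l] (1 : X → ℝ) := by
    refine ((hc.inner (hv j)).isBigO_one ℝ).add (IsBigO.fun_sum fun i _ => ?_)
    simpa using (hlam i).mul (((ha i).inner (hv j)).isBigO_one ℝ)
  refine h1.neg_left.congr' ?_ EventuallyEq.rfl
  filter_upwards [hbv, hstat] with p hbv hstat
  have h2 := congrArg (fun z => (inner ℝ z (v j p) : ℝ)) hstat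
  simp only [inner_add_left, sum_inner, real_inner_smul_left, hbv, mul_ite, mul_one, mul_zero,
    Finset.sum_ite_eq', Finset.mem_univ, if_true, inner_zero_left] at h2
  linarith

end Stability

/-! ### Smooth data of the parametric program -/

section Smooth

variable {n s : ℕ} {φ : EuclideanSpace ℝ (Fin n) → EuclideanSpace ℝ (Fin s) → ℝ}
  {xb : EuclideanSpace ℝ (Fin n)} {ωb : EuclideanSpace ℝ (Fin s)}

theorem hasFDerivAt_gradX {x : EuclideanSpace ℝ (Fin n)}
    {ω : EuclideanSpace ℝ (Fin s)} (h : DifferentiableAt ℝ (fun y => φ y ω) x) :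
    HasFDerivAt (fun y => φ y ω) (innerSL ℝ (gradX φ x ω)) x :=
  h.hasGradientAt.hasFDerivAt

theorem gradX_eq_of_hasFDerivAt {x v : EuclideanSpace ℝ (Fin n)} {ω : EuclideanSpace ℝ (Fin s)}
    (h : HasFDerivAt (fun y => φ y ω) (innerSL ℝ v) x) : gradX φ x ω = v :=
  (hasGradientAt_iff_hasFDerivAt.2 h).gradient

/-- Near the base point the function is strictly differentiable in `x`, because its gradient, being
differentiable in `x`, is continuous in `x`. Strictness is what the implicit function theorem
needs. -/
theorem IsTwiceSmoothInX.eventually {U : Set (EuclideanSpace ℝ (Fin n))}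
    {W : Set (EuclideanSpace ℝ (Fin s))} (hφ : IsTwiceSmoothInX φ xb ωb U W) (hU : U ∈ 𝓝 xb)
    (hW : W ∈ 𝓝 ωb) :
    ∀ᶠ p in 𝓝 (xb, ωb),
      HasStrictFDerivAt (fun y => φ y p.2) (innerSL ℝ (gradX φ p.1 p.2)) p.1 ∧
      HasFDerivAt (fun y => gradX φ y p.2) (hessX φ p.1 p.2) p.1 := by
  filter_upwards [continuousAt_fst.eventually (eventually_mem_nhds_iff.2 hU),
    continuousAt_snd.eventually hW] with p hpU hpW
  have hgrad := hφ.grad_differentiable p.1 (mem_of_mem_nhds hpU) p.2 hpW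
  refine ⟨?_, hgrad.hasFDerivAt⟩
  refine hasStrictFDerivAt_of_hasFDerivAt_of_continuousAt
    (f' := fun y => innerSL ℝ (gradX φ y p.2)) ?_
    ((innerSL ℝ).continuous.continuousAt.comp hgrad.continuousAt)
  filter_upwards [hpU] with y hy
  exact hasFDerivAt_gradX (hφ.differentiable y hy p.2 hpW)

end Smooth

/-- Difference quotients along points that approach `xb` in the direction `u`, while the parameters
converge faster than the points. -/
theorem tendsto_inv_norm_smul_sub {s : ℕ} {E G : Type*} [NormedAddCommGroup E]
    [NormedSpace ℝ E] [NormedAddCommGroup G] [NormedSpace ℝ G]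
    {F : E → EuclideanSpace ℝ (Fin s) → G} {F' : E × EuclideanSpace ℝ (Fin s) → E →L[ℝ] G}
    {xb u : E} {ωb : EuclideanSpace ℝ (Fin s)}
    (hF : ∀ᶠ p in 𝓝 (xb, ωb), HasFDerivAt (fun y => F y p.2) (F' p) p.1)
    (hF' : ContinuousAt F' (xb, ωb)) (hLip : LipschitzNear (F xb) ωb)
    {α : Type*} {l : Filter α} {x : α → E} {ω : α → EuclideanSpace ℝ (Fin s)}
    (hx : Tendsto x l (𝓝 xb)) (hω : Tendsto ω l (𝓝 ωb))
    (hωx : (fun k => ω k - ωb) =o[l] fun k => x k - xb)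
    (hu : Tendsto (fun k => ‖x k - xb‖⁻¹ • (x k - xb)) l (𝓝 u)) :
    Tendsto (fun k => ‖x k - xb‖⁻¹ • (F (x k) (ω k) - F xb ωb)) l (𝓝 (F' (xb, ωb) u)) := by
  have h1 := (isLittleO_sub_sub_of_lipschitzNear hF hF' hLip hx hω
    hωx).norm_right.tendsto_inv_smul_nhds_zero
  have h2 := h1.add (((F' (xb, ωb)).continuous.tendsto u).comp hu)
  rw [zero_add] at h2
  refine h2.congr fun k => ?_
  simp only [Function.comp_apply, map_smul]
  rw [← smul_add, sub_add_cancel]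

namespace ParametricNLP

variable {n s mI mE : ℕ} {D : ParametricNLP n s mI mE}
  {xb : EuclideanSpace ℝ (Fin n)} {ωb : EuclideanSpace ℝ (Fin s)}

theorem hasFDerivAt_lagrangian {x : EuclideanSpace ℝ (Fin n)} {ω : EuclideanSpace ℝ (Fin s)}
    (hf : HasFDerivAt (fun y => D.f y ω) (innerSL ℝ (gradX D.f x ω)) x)
    (hg : ∀ i, HasFDerivAt (fun y => D.g i y ω) (innerSL ℝ (gradX (D.g i) x ω)) x)
    (hh : ∀ j, HasFDerivAt (fun y => D.h j y ω) (innerSL ℝ (gradX (D.h j) x ω)) x)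
    (l0 : ℝ) (lg : Fin mI → ℝ) (lh : Fin mE → ℝ) :
    HasFDerivAt (fun y => D.lagrangian l0 lg lh y ω)
      (innerSL ℝ (l0 • gradX D.f x ω + ∑ i, lg i • gradX (D.g i) x ω
        + ∑ j, lh j • gradX (D.h j) x ω)) x := by
  simp only [map_add, map_sum, map_smul]
  exact ((hf.const_mul l0).add (HasFDerivAt.fun_sum fun i _ => (hg i).const_mul (lg i))).add
    (HasFDerivAt.fun_sum fun j _ => (hh j).const_mul (lh j))

/-- The differentiability and continuity properties of the data that hold at or near the base
point. -/
structure RegularData (D : ParametricNLP n s mI mE) (xb : EuclideanSpace ℝ (Fin n))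
    (ωb : EuclideanSpace ℝ (Fin s)) : Prop where
  near : ∀ᶠ p in 𝓝 (xb, ωb),
    (HasStrictFDerivAt (fun y => D.f y p.2) (innerSL ℝ (gradX D.f p.1 p.2)) p.1 ∧
      HasFDerivAt (fun y => gradX D.f y p.2) (hessX D.f p.1 p.2) p.1) ∧
    (∀ i, HasStrictFDerivAt (fun y => D.g i y p.2) (innerSL ℝ (gradX (D.g i) p.1 p.2)) p.1 ∧
      HasFDerivAt (fun y => gradX (D.g i) y p.2) (hessX (D.g i) p.1 p.2) p.1) ∧
    (∀ j, HasStrictFDerivAt (fun y => D.h j y p.2) (innerSL ℝ (gradX (D.h j) p.1 p.2)) p.1 ∧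
      HasFDerivAt (fun y => gradX (D.h j) y p.2) (hessX (D.h j) p.1 p.2) p.1)
  grad_f : ContinuousAt (fun p : _ × _ => gradX D.f p.1 p.2) (xb, ωb)
  grad_g : ∀ i, ContinuousAt (fun p : _ × _ => gradX (D.g i) p.1 p.2) (xb, ωb)
  grad_h : ∀ j, ContinuousAt (fun p : _ × _ => gradX (D.h j) p.1 p.2) (xb, ωb)
  hess_f : ContinuousAt (fun p : _ × _ => hessX D.f p.1 p.2) (xb, ωb)
  hess_g : ∀ i, ContinuousAt (fun p : _ × _ => hessX (D.g i) p.1 p.2) (xb, ωb)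
  hess_h : ∀ j, ContinuousAt (fun p : _ × _ => hessX (D.h j) p.1 p.2) (xb, ωb)
  cont_g : ∀ i, ContinuousAt (fun p : _ × _ => D.g i p.1 p.2) (xb, ωb)

theorem BasicAssumption.regularData (h : D.BasicAssumption xb ωb) : D.RegularData xb ωb := by
  obtain ⟨⟨U, hU, W, hW, hf, hg, hh⟩, hcg, -⟩ := h
  exact
    { near := (hf.eventually hU hW).and ((eventually_all.2 fun i => (hg i).eventually hU hW).and
        (eventually_all.2 fun j => (hh j).eventually hU hW))
      grad_f := hf.grad_continuousAt
      grad_g := fun i => (hg i).grad_continuousAt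
      grad_h := fun j => (hh j).grad_continuousAt
      hess_f := hf.hess_continuousAt
      hess_g := fun i => (hg i).hess_continuousAt
      hess_h := fun j => (hh j).hess_continuousAt
      cont_g := hcg }

theorem RegularData.gradX_lagrangian (hD : D.RegularData xb ωb) :
    ∀ᶠ p in 𝓝 (xb, ωb), ∀ l0 lg lh, gradX (D.lagrangian l0 lg lh) p.1 p.2 =
      l0 • gradX D.f p.1 p.2 + ∑ i, lg i • gradX (D.g i) p.1 p.2
        + ∑ j, lh j • gradX (D.h j) p.1 p.2 := by
  filter_upwards [hD.near] with p hp l0 lg lh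
  exact gradX_eq_of_hasFDerivAt (hasFDerivAt_lagrangian hp.1.1.hasFDerivAt
    (fun i => (hp.2.1 i).1.hasFDerivAt) (fun j => (hp.2.2 j).1.hasFDerivAt) l0 lg lh)

theorem RegularData.hessX_lagrangian (hD : D.RegularData xb ωb) (l0 : ℝ) (lg : Fin mI → ℝ)
    (lh : Fin mE → ℝ) :
    hessX (D.lagrangian l0 lg lh) xb ωb =
      l0 • hessX D.f xb ωb + ∑ i, lg i • hessX (D.g i) xb ωb
        + ∑ j, lh j • hessX (D.h j) xb ωb := by
  have hp := hD.near.self_of_nhds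
  have hsum : HasFDerivAt (fun y => l0 • gradX D.f y ωb + ∑ i, lg i • gradX (D.g i) y ωb
      + ∑ j, lh j • gradX (D.h j) y ωb) (l0 • hessX D.f xb ωb + ∑ i, lg i • hessX (D.g i) xb ωb
        + ∑ j, lh j • hessX (D.h j) xb ωb) xb :=
    ((hp.1.2.const_smul l0).add (HasFDerivAt.fun_sum fun i _ => (hp.2.1 i).2.const_smul (lg i))).add
      (HasFDerivAt.fun_sum fun j _ => (hp.2.2 j).2.const_smul (lh j))
  refine (hsum.congr_of_eventuallyEq ?_).fderiv
  have hline : Tendsto (fun y => (y, ωb)) (𝓝 xb) (𝓝 (xb, ωb)) :=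
    tendsto_id.prodMk_nhds tendsto_const_nhds
  filter_upwards [hline.eventually hD.gradX_lagrangian] with y hy
  exact hy l0 lg lh

/-! ### KKT points and stationary points near the base point -/

/-- A stationary point in the KKT sense is stationary: the constraint part of the Lagrangian is
nonpositive on the feasible set, vanishes at the point and has gradient `-∇ₓ f` there. -/
theorem RegularData.mem_stationarySet (hD : D.RegularData xb ωb) (hKKT : D.IsKKTPoint xb ωb) :
    xb ∈ D.stationarySet ωb := by
  obtain ⟨hfeas, ⟨lg, lh⟩, hpos, hgrad, hcompl⟩ := hKKT
  have hp := hD.near.self_of_nhds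
  rw [hD.gradX_lagrangian.self_of_nhds, one_smul] at hgrad
  refine ⟨-gradX D.f xb ωb, ⟨hfeas, fun ε hε => ?_⟩, add_neg_cancel _⟩
  have hder := hasFDerivAt_lagrangian hp.1.1.hasFDerivAt
    (fun i => (hp.2.1 i).1.hasFDerivAt) (fun j => (hp.2.2 j).1.hasFDerivAt) 0 lg lh
  have heq : (0 : ℝ) • gradX D.f xb ωb + ∑ i, lg i • gradX (D.g i) xb ωb
      + ∑ j, lh j • gradX (D.h j) xb ωb = -gradX D.f xb ωb := by
    rw [zero_smul, zero_add, eq_neg_iff_add_eq_zero, ← hgrad]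
    abel
  rw [heq, hasFDerivAt_iff_isLittleO] at hder
  have hbase : D.lagrangian 0 lg lh xb ωb = 0 := by
    simpa [lagrangian, hfeas.2] using hcompl
  filter_upwards [(hder.bound hε).filter_mono nhdsWithin_le_nhds, self_mem_nhdsWithin]
    with y hy hyF
  have hnonpos : D.lagrangian 0 lg lh y ωb ≤ 0 := by
    simpa [lagrangian, hyF.2] using
      Finset.sum_nonpos fun i _ => mul_nonpos_of_nonneg_of_nonpos (hpos i) (hyF.1 i)
  have h1 := neg_le_of_abs_le hy
  rw [hbase, sub_zero, innerSL_apply_apply] at h1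
  linarith

/-- Stationarity, sign and complementarity conditions for multipliers, written with the gradients
of the data; complementarity is imposed on each constraint separately. -/
def IsMultiplier (D : ParametricNLP n s mI mE)
    (p : EuclideanSpace ℝ (Fin n) × EuclideanSpace ℝ (Fin s)) (lg : Fin mI → ℝ)
    (lh : Fin mE → ℝ) : Prop :=
  (∀ i, 0 ≤ lg i) ∧ (∀ i, D.g i p.1 p.2 ≠ 0 → lg i = 0) ∧
    gradX D.f p.1 p.2 + ∑ i, lg i • gradX (D.g i) p.1 p.2
      + ∑ j, lh j • gradX (D.h j) p.1 p.2 = 0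

/-- The Mangasarian-Fromovitz condition at the base point makes all nearby stationary points KKT
points, with uniformly bounded multipliers. -/
theorem RegularData.exists_bounded_multipliers (hD : D.RegularData xb ωb)
    (hMFCQ : D.MFCQ xb ωb) :
    ∃ C : ℝ, ∀ᶠ p in 𝓝 (xb, ωb), p.1 ∈ D.stationarySet p.2 →
      ∃ lg lh, D.IsMultiplier p lg lh ∧ ‖lg‖ ≤ C ∧ ‖lh‖ ≤ C := by
  classical
  obtain ⟨hli, d₀, hd₀h, hd₀g⟩ := hMFCQ
  obtain ⟨v, v₀, hv, hbv⟩ := exists_tendsto_biorthogonal hD.grad_h hli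
  obtain ⟨d, hd, hbd⟩ := exists_tendsto_orthogonal hD.grad_h hv hbv hd₀h
  have hinactive : ∀ᶠ p in 𝓝 (xb, ωb), ∀ i, D.g i xb ωb ≠ 0 → D.g i p.1 p.2 ≠ 0 := by
    refine eventually_all.2 fun i => ?_
    by_cases hi : D.g i xb ωb = 0
    · simp [hi]
    · filter_upwards [(hD.cont_g i).eventually_ne hi] with p hp _ using hp
  have hstrict : ∀ᶠ p in 𝓝 (xb, ωb), ∀ i, D.g i xb ωb = 0 →
      inner ℝ (gradX (D.g i) p.1 p.2) (d p) < 0 := by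
    refine eventually_all.2 fun i => ?_
    by_cases hi : D.g i xb ωb = 0
    · filter_upwards [((hD.grad_g i).tendsto.inner hd).eventually (gt_mem_nhds (hd₀g i hi))]
        with p hp _ using hp
    · simp [hi]
  have hex : ∀ᶠ p in 𝓝 (xb, ωb), p.1 ∈ D.stationarySet p.2 →
      ∃ lg lh, D.IsMultiplier p lg lh := by
    filter_upwards [hbv, hbd, hinactive, hstrict, hD.near] with p hbv hbd hinactive hstrict hnear
    rintro ⟨ξ, hξ, hfξ⟩
    have hcone := mem_signedCone_of_mem_frechetNormalCone (d := d p)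
      (s := Finset.univ.filter (Sum.elim (fun i => D.g i p.1 p.2 = 0) fun _ => True))
      (b := fun j => gradX (D.h j) p.1 p.2) (v := fun j => v j p) hξ
      (fun i => (hnear.2.1 i).1.hasFDerivAt) (fun j => (hnear.2.2 j).1) hbv hbd
      (fun i hi => hstrict i (by_contra fun h => hinactive i h hi)) (by simp) (by simp)
    obtain ⟨c, hc, hc0, hsum⟩ := mem_signedCone_iff_support.1 hcone
    refine ⟨fun i => c (Sum.inl i), fun j => c (Sum.inr j), fun i => hc _ ⟨i, rfl⟩,
      fun i hi => hc0 _ (by simpa using hi), ?_⟩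
    rw [Fintype.sum_sum_type] at hsum
    simp only [Sum.elim_inl, Sum.elim_inr] at hsum
    rw [add_assoc, hsum, hfξ]
  have hchoice : ∀ p, ∃ lg lh, (∃ lg lh, D.IsMultiplier p lg lh) → D.IsMultiplier p lg lh := by
    intro p
    by_cases h : ∃ lg lh, D.IsMultiplier p lg lh
    · obtain ⟨lg, lh, hl⟩ := h
      exact ⟨lg, lh, fun _ => hl⟩
    · exact ⟨0, 0, fun h' => absurd h' h⟩
  choose lg lh hl using hchoice
  -- The bound holds along the neighbourhood filter restricted to the graph of the stationary map.
  let F := 𝓝 (xb, ωb) ⊓ 𝓟 {p | p.1 ∈ D.stationarySet p.2}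
  have hF : F ≤ 𝓝 (xb, ωb) := inf_le_left
  have hgood : ∀ᶠ p in F, D.IsMultiplier p (lg p) (lh p) := by
    rw [eventually_inf_principal]
    filter_upwards [hex] with p hp
    exact fun hS => hl p (hp hS)
  obtain ⟨hO1, hO2⟩ := multipliers_isBigO_one (A := {i | D.g i xb ωb = 0}) (lam := lg) (mu := lh)
    (hD.grad_f.tendsto.mono_left hF) (fun i => (hD.grad_g i).tendsto.mono_left hF)
    (fun j => (hv j).mono_left hF) (hd.mono_left hF) (hbv.filter_mono hF) (hbd.filter_mono hF)
    hd₀g (hgood.mono fun p hp => hp.1)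
    ((hgood.and (hinactive.filter_mono hF)).mono fun p hp i hi => hp.1.2.1 i (hp.2 i hi))
    (hgood.mono fun p hp => hp.2.2)
  obtain ⟨C₁, hC₁⟩ := hO1.bound
  obtain ⟨C₂, hC₂⟩ := hO2.bound
  refine ⟨max C₁ C₂, ?_⟩
  filter_upwards [eventually_inf_principal.1 (hgood.and (hC₁.and hC₂))] with p hp hS
  obtain ⟨h1, h2, h3⟩ := hp hS
  simp only [Pi.one_apply, norm_one, mul_one] at h2 h3
  exact ⟨lg p, lh p, h1, h2.trans (le_max_left _ _), h3.trans (le_max_right _ _)⟩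

/-! ### Passing to the limit -/

/-- Limits of KKT points and multipliers: if KKT points approach `xb` in the direction `u`, with
multipliers converging to `(lg, lh)` and parameters converging faster than the points, then
`(lg, lh)` is a multiplier at the base point and `u` solves the linearized system for it. -/
theorem RegularData.solvesLinearizedSystem_of_tendsto (hD : D.RegularData xb ωb)
    (hLip : D.LipschitzData xb ωb) (hfeas : xb ∈ D.feasibleSet ωb)
    {α : Type*} {l : Filter α} [l.NeBot] {x : α → EuclideanSpace ℝ (Fin n)}
    {ω : α → EuclideanSpace ℝ (Fin s)} {lgk : α → Fin mI → ℝ} {lhk : α → Fin mE → ℝ}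
    {u : EuclideanSpace ℝ (Fin n)} {lg : Fin mI → ℝ} {lh : Fin mE → ℝ}
    (hx : Tendsto x l (𝓝 xb)) (hω : Tendsto ω l (𝓝 ωb))
    (hωx : (fun k => ω k - ωb) =o[l] fun k => x k - xb)
    (hu : Tendsto (fun k => ‖x k - xb‖⁻¹ • (x k - xb)) l (𝓝 u))
    (hlg : Tendsto lgk l (𝓝 lg)) (hlh : Tendsto lhk l (𝓝 lh))
    (hxF : ∀ᶠ k in l, x k ∈ D.feasibleSet (ω k)) (hxne : ∀ᶠ k in l, x k ≠ xb)
    (hmul : ∀ᶠ k in l, D.IsMultiplier (x k, ω k) (lgk k) (lhk k)) :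
    (lg, lh) ∈ D.multipliers xb ωb ∧
      ∃ α β, D.SolvesLinearizedSystem xb ωb lg lh u α β := by
  classical
  obtain ⟨hpos, hcompl, hstat⟩ : (∀ᶠ k in l, ∀ i, 0 ≤ lgk k i) ∧
      (∀ᶠ k in l, ∀ i, D.g i (x k) (ω k) ≠ 0 → lgk k i = 0) ∧
      ∀ᶠ k in l, gradX D.f (x k) (ω k) + ∑ i, lgk k i • gradX (D.g i) (x k) (ω k)
        + ∑ j, lhk k j • gradX (D.h j) (x k) (ω k) = 0 :=
    ⟨hmul.mono fun k hk => hk.1, hmul.mono fun k hk => hk.2.1, hmul.mono fun k hk => hk.2.2⟩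
  obtain ⟨-, hLf', hLg, hLg', hLh, hLh'⟩ := hLip
  have hlgi := tendsto_pi_nhds.1 hlg
  have hlhj := tendsto_pi_nhds.1 hlh
  have hxω := hx.prodMk_nhds hω
  have hinner : Continuous fun w : EuclideanSpace ℝ (Fin n) => innerSL ℝ w :=
    (innerSL ℝ).continuous
  -- Difference quotients of the constraints and of all gradients.
  have hqg : ∀ i, Tendsto (fun k => ‖x k - xb‖⁻¹ • (D.g i (x k) (ω k) - D.g i xb ωb)) l
      (𝓝 (inner ℝ (gradX (D.g i) xb ωb) u)) := fun i =>
    tendsto_inv_norm_smul_sub (hD.near.mono fun p hp => (hp.2.1 i).1.hasFDerivAt)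
      (hinner.continuousAt.comp (hD.grad_g i)) (hLg i) hx hω hωx hu
  have hqh : ∀ j, Tendsto (fun k => ‖x k - xb‖⁻¹ • (D.h j (x k) (ω k) - D.h j xb ωb)) l
      (𝓝 (inner ℝ (gradX (D.h j) xb ωb) u)) := fun j =>
    tendsto_inv_norm_smul_sub (hD.near.mono fun p hp => (hp.2.2 j).1.hasFDerivAt)
      (hinner.continuousAt.comp (hD.grad_h j)) (hLh j) hx hω hωx hu
  have hqf' := tendsto_inv_norm_smul_sub (hD.near.mono fun p hp => hp.1.2) hD.hess_f hLf' hx hω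
    hωx hu
  have hqg' := fun i => tendsto_inv_norm_smul_sub (hD.near.mono fun p hp => (hp.2.1 i).2)
    (hD.hess_g i) (hLg' i) hx hω hωx hu
  have hqh' := fun j => tendsto_inv_norm_smul_sub (hD.near.mono fun p hp => (hp.2.2 j).2)
    (hD.hess_h j) (hLh' j) hx hω hωx hu
  have htpos : ∀ᶠ k in l, 0 < ‖x k - xb‖⁻¹ := hxne.mono fun k hk =>
    inv_pos.2 (norm_pos_iff.2 (sub_ne_zero.2 hk))
  have hlgpos : ∀ i, 0 ≤ lg i := fun i => ge_of_tendsto (hlgi i) (hpos.mono fun k hk => hk i)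
  have hstat₀ : gradX D.f xb ωb + ∑ i, lg i • gradX (D.g i) xb ωb
      + ∑ j, lh j • gradX (D.h j) xb ωb = 0 := by
    have hlim := ((hD.grad_f.tendsto.comp hxω).add (tendsto_finsetSum Finset.univ fun i _ =>
      (hlgi i).smul ((hD.grad_g i).tendsto.comp hxω))).add (tendsto_finsetSum Finset.univ fun j _ =>
      (hlhj j).smul ((hD.grad_h j).tendsto.comp hxω))
    exact tendsto_nhds_unique (hlim.congr' hstat) tendsto_const_nhds
  -- Inequalities that are inactive up to first order have vanishing multipliers.
  have hzero : ∀ i, ¬ (D.g i xb ωb = 0 ∧ (0 < lg i ∨ inner ℝ (gradX (D.g i) xb ωb) u = 0)) →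
      D.g i xb ωb = 0 → inner ℝ (gradX (D.g i) xb ωb) u ≤ 0 → ∀ᶠ k in l, lgk k i = 0 := by
    intro i hi hgi hle
    have hlt : inner ℝ (gradX (D.g i) xb ωb) u < 0 := hle.lt_of_ne fun h => hi ⟨hgi, Or.inr h⟩
    filter_upwards [(hqg i).eventually (gt_mem_nhds hlt), hcompl] with k hk hc
    refine hc i fun h => ?_
    simp [h, hgi] at hk
  have hinactive : ∀ i, D.g i xb ωb ≠ 0 → ∀ᶠ k in l, lgk k i = 0 := by
    intro i hi
    filter_upwards [((hD.cont_g i).tendsto.comp hxω).eventually_ne hi, hcompl] with k hk hc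
    exact hc i hk
  have hlim0 : ∀ i, (∀ᶠ k in l, lgk k i = 0) → lg i = 0 := fun i hi =>
    tendsto_nhds_unique ((hlgi i).congr' hi) tendsto_const_nhds
  have hcone : u ∈ D.linTangentCone xb ωb := by
    refine ⟨fun i hi => le_of_tendsto (hqg i) ?_, fun j => ?_⟩
    · filter_upwards [hxF, htpos] with k hk ht
      rw [hi, sub_zero, smul_eq_mul]
      exact mul_nonpos_of_nonneg_of_nonpos ht.le (hk.1 i)
    · refine tendsto_nhds_unique ((hqh j).congr' ?_) tendsto_const_nhds
      filter_upwards [hxF] with k hk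
      rw [hk.2 j, hfeas.2 j, sub_zero, smul_zero]
  have hmult : (lg, lh) ∈ D.multipliers xb ωb := by
    refine ⟨hlgpos, ?_, Finset.sum_eq_zero fun i _ => ?_⟩
    · rw [hD.gradX_lagrangian.self_of_nhds, one_smul]
      exact hstat₀
    · by_cases hi : D.g i xb ωb = 0
      · simp [hi]
      · simp [hlim0 i (hinactive i hi)]
  refine ⟨hmult, ?_⟩
  -- The quotients of the multiplier differences generate elements of a closed cone.
  let S : Finset (Fin mI ⊕ Fin mE) := Finset.univ.filter (Sum.elim
    (fun i => D.g i xb ωb = 0 ∧ (0 < lg i ∨ inner ℝ (gradX (D.g i) xb ωb) u = 0)) fun _ => True)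
  let N : Set (Fin mI ⊕ Fin mE) := Sum.inl '' {i | lg i = 0}
  have hSzero : ∀ i, Sum.inl i ∉ S → ∀ᶠ k in l, lgk k i = 0 := by
    intro i hi
    have hi : ¬ (D.g i xb ωb = 0 ∧ (0 < lg i ∨ inner ℝ (gradX (D.g i) xb ωb) u = 0)) := by
      simpa [S] using hi
    by_cases hgi : D.g i xb ωb = 0
    · exact hzero i hi hgi (hcone.1 i hgi)
    · exact hinactive i hgi
  have hSzero' : ∀ᶠ k in l, ∀ i, Sum.inl i ∉ S → lgk k i = 0 := by
    refine eventually_all.2 fun i => ?_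
    by_cases hi : Sum.inl i ∈ S
    · exact Eventually.of_forall fun k h => absurd hi h
    · exact (hSzero i hi).mono fun k hk _ => hk
  have hlimK := (hqf'.add (tendsto_finsetSum Finset.univ fun i _ =>
      (hlgi i).smul (hqg' i))).add (tendsto_finsetSum Finset.univ fun j _ =>
      (hlhj j).smul (hqh' j))
  have hmemK := (isClosed_signedCone S N
    (Sum.elim (fun i => gradX (D.g i) xb ωb) fun j => gradX (D.h j) xb ωb)).mem_of_tendsto
    hlimK.neg (by
      filter_upwards [hpos, hstat, hSzero'] with k hpos hstat hS0
      refine mem_signedCone_iff_support.2 ⟨Sum.elim (fun i => ‖x k - xb‖⁻¹ * (lgk k i - lg i))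
        fun j => ‖x k - xb‖⁻¹ * (lhk k j - lh j), ?_, ?_, ?_⟩
      · rintro _ ⟨i, hi, rfl⟩
        have hi : lg i = 0 := hi
        simpa [hi] using mul_nonneg (inv_nonneg.2 (norm_nonneg (x k - xb))) (hpos i)
      · rintro (i | j) hij
        · simp [hS0 i hij, hlim0 i (hSzero i hij)]
        · simp [S] at hij
      · rw [Fintype.sum_sum_type]
        simp only [Sum.elim_inl, Sum.elim_inr, mul_smul]
        simp only [smul_comm _ (‖x k - xb‖⁻¹), ← Finset.smul_sum, ← smul_add, ← smul_neg]
        congr 1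
        simp only [sub_smul, smul_sub, Finset.sum_sub_distrib]
        rw [← sub_eq_zero, ← sub_self (0 : EuclideanSpace ℝ (Fin n))]
        nth_rewrite 1 [← hstat]
        rw [← hstat₀]
        abel)
  obtain ⟨c, hc, hc0, hsum⟩ := mem_signedCone_iff_support.1 hmemK
  rw [Fintype.sum_sum_type] at hsum
  simp only [Sum.elim_inl, Sum.elim_inr] at hsum
  refine ⟨fun i => c (Sum.inl i), fun j => c (Sum.inr j), hcone, ?_, ?_, ?_, ?_⟩
  · rw [hD.hessX_lagrangian, hD.gradX_lagrangian.self_of_nhds, zero_smul, zero_add, hsum]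
    simp
  · intro i hgi hlgi'
    refine tendsto_nhds_unique ((hqg i).congr' ?_) tendsto_const_nhds
    filter_upwards [(hlgi i).eventually (lt_mem_nhds hlgi'), hcompl] with k hk hc
    have : D.g i (x k) (ω k) = 0 := by_contra fun h => hk.ne' (hc i h)
    rw [this, hgi, sub_zero, smul_zero]
  · intro i hgi hlgi'
    refine ⟨hc _ ⟨i, hlgi', rfl⟩, ?_⟩
    by_cases hi : inner ℝ (gradX (D.g i) xb ωb) u = 0
    · rw [hi, mul_zero]
    · rw [hc0 _ (by simp [S, hlgi', hi]), zero_mul]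
  · exact fun i hi => hc0 _ (by simp [S, hi])

end ParametricNLP

theorem mainTheorem9 {n s mI mE : ℕ} (D : ParametricNLP n s mI mE)
    (xb : EuclideanSpace ℝ (Fin n)) (ωb : EuclideanSpace ℝ (Fin s))
    (hbasic : D.BasicAssumption xb ωb)
    (hLip : D.LipschitzData xb ωb)
    (hKKT : D.IsKKTPoint xb ωb)
    (hMFCQ : D.MFCQ xb ωb)
    (hsys : ∀ l ∈ D.multipliers xb ωb,
      ¬ ∃ (u : EuclideanSpace ℝ (Fin n)) (α : Fin mI → ℝ) (β : Fin mE → ℝ),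
        D.SolvesLinearizedSystem xb ωb l.1 l.2 u α β ∧ u ≠ 0) :
    IsLocallyUpperLipschitzAt D.stationarySet ωb xb := by
  have hD := hbasic.regularData
  refine ⟨hD.mem_stationarySet hKKT, ?_⟩
  by_contra hnot
  -- Stationary points violating the estimate with constant `k + 1` in balls of radius `1 / (k + 1)`.
  have hseq : ∀ k : ℕ, ∃ p : EuclideanSpace ℝ (Fin n) × EuclideanSpace ℝ (Fin s),
      p ∈ Metric.ball (xb, ωb) (1 / ((k : ℝ) + 1)) ∧ p.1 ∈ D.stationarySet p.2 ∧
      ((k : ℝ) + 1) * ‖p.2 - ωb‖ < ‖p.1 - xb‖ := by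
    intro k
    by_contra hk
    push Not at hk
    have hr : (0 : ℝ) < 1 / ((k : ℝ) + 1) := by positivity
    refine hnot ⟨_, Metric.ball_mem_nhds xb hr, _, Metric.ball_mem_nhds ωb hr, (k : ℝ) + 1,
      by positivity, fun ω hω x hx => ?_⟩
    rw [mem_closedBall_iff_norm]
    exact hk (x, ω) (by rw [← ball_prod_same]; exact ⟨hx.2, hω⟩) hx.1
  choose p hball hS hlt using hseq
  have hp : Tendsto p atTop (𝓝 (xb, ωb)) := by
    rw [tendsto_iff_dist_tendsto_zero]
    exact squeeze_zero (fun _ => dist_nonneg) (fun k => (hball k).le)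
      tendsto_one_div_add_atTop_nhds_zero_nat
  have hne : ∀ k, (p k).1 ≠ xb := by
    intro k h
    have h1 := hlt k
    rw [h, sub_self, norm_zero] at h1
    exact h1.not_ge (by positivity)
  have hlittle : (fun k => (p k).2 - ωb) =o[atTop] fun k => (p k).1 - xb := by
    rw [isLittleO_iff]
    intro c hc
    have := (tendsto_one_div_add_atTop_nhds_zero_nat (𝕜 := ℝ)).eventually (gt_mem_nhds hc)
    filter_upwards [this] with k hk
    have hk1 : (0 : ℝ) < (k : ℝ) + 1 := by positivity
    calc ‖(p k).2 - ωb‖ ≤ 1 / ((k : ℝ) + 1) * ‖(p k).1 - xb‖ := by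
          rw [one_div_mul_eq_div, le_div_iff₀ hk1, mul_comm]
          exact (hlt k).le
      _ ≤ c * ‖(p k).1 - xb‖ := by gcongr
  obtain ⟨C, hC⟩ := hD.exists_bounded_multipliers hMFCQ
  obtain ⟨k₀, hk₀⟩ := eventually_atTop.1 (hp.eventually hC)
  have hmult := fun k : ℕ => hk₀ (k + k₀) (Nat.le_add_left _ _) (hS _)
  choose lgk lhk hmul hlgC hlhC using hmult
  let x : ℕ → EuclideanSpace ℝ (Fin n) := fun k => (p (k + k₀)).1
  let ω : ℕ → EuclideanSpace ℝ (Fin s) := fun k => (p (k + k₀)).2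
  let dir : ℕ → EuclideanSpace ℝ (Fin n) := fun k => ‖x k - xb‖⁻¹ • (x k - xb)
  have hdir : ∀ k, ‖dir k‖ = 1 := fun k => by
    have : ‖x k - xb‖ ≠ 0 := norm_ne_zero_iff.2 (sub_ne_zero.2 (hne _))
    simp only [dir, norm_smul, norm_inv, norm_norm]
    exact inv_mul_cancel₀ this
  have hbdd : ∀ k, (dir k, lgk k, lhk k) ∈ Metric.closedBall
      (0 : EuclideanSpace ℝ (Fin n) × (Fin mI → ℝ) × (Fin mE → ℝ)) (max 1 C) := by
    intro k
    rw [mem_closedBall_zero_iff]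
    exact max_le ((hdir k).le.trans (le_max_left _ _))
      (max_le ((hlgC k).trans (le_max_right _ _)) ((hlhC k).trans (le_max_right _ _)))
  obtain ⟨⟨u, lg, lh⟩, -, φ, hφ, hlim⟩ := tendsto_subseq_of_bounded Metric.isBounded_closedBall hbdd
  rw [nhds_prod_eq, nhds_prod_eq] at hlim
  have hu := hlim.fst
  have hlg := hlim.snd.fst
  have hlh := hlim.snd.snd
  have hshift : Tendsto (fun k => φ k + k₀) atTop atTop :=
    (tendsto_add_atTop_nat k₀).comp hφ.tendsto_atTop
  have hfeas : ∀ k, x k ∈ D.feasibleSet (ω k) := fun k => by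
    obtain ⟨ξ, hξ, -⟩ := hS (k + k₀)
    exact hξ.1
  obtain ⟨hl, α, β, hsol⟩ := hD.solvesLinearizedSystem_of_tendsto hLip hKKT.1
    (x := fun k => x (φ k)) (ω := fun k => ω (φ k))
    ((continuous_fst.tendsto _).comp (hp.comp hshift))
    ((continuous_snd.tendsto _).comp (hp.comp hshift)) (hlittle.comp_tendsto hshift) hu hlg hlh
    (Eventually.of_forall fun k => hfeas _) (Eventually.of_forall fun k => hne _)
    (Eventually.of_forall fun k => hmul _)
  have hu1 : ‖u‖ = 1 := tendsto_nhds_unique hu.norm (by simp [hdir])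
  exact hsys _ hl ⟨u, α, β, hsol, fun h => by simp [h] at hu1⟩
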